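/- Let $A$ be a (left and right) noetherian ring with unit that is semiperfect, that is, every finitely generated left $A$-module and every finitely generated right $A$-module has a projective cover. Let $J$ be the Jacobson radical of $A$. Write $\operatorname{inj\,dim}_A$ and $\operatorname{inj\,dim}_{A^{\mathrm{op}}}$ for the injective dimension of left, respectively right, $A$-modules, and $\operatorname{gl\,dim} A$ for the supremum of the projective dimensions of all left $A$-modules; all dimensions take values in $\{0,1,2,\dots\}\cup\{\infty\}$, and the zero module has dimension $0$. Then $$\operatorname{inj\,dim}_A J=\operatorname{gl\,dim} A .$$ In particular, $\operatorname{inj\,dim}_A J=\operatorname{inj\,dim}_{A^{\mathrm{op}}} J$. -/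

import Mathlib

open CategoryTheory

universe u

/-- A submodule `K` of `P` is superfluous (small): `N + K = P` implies `N = P`. -/
def IsSuperfluous {R : Type u} [Ring R] {P : Type u} [AddCommGroup P] [Module R P]
    (K : Submodule R P) : Prop :=
  ∀ N : Submodule R P, N ⊔ K = ⊤ → N = ⊤

/-- `M` has a projective cover: a surjection from a projective module onto `M` whose kernel
is superfluous. -/
def HasProjectiveCover (R : Type u) [Ring R] (M : Type u) [AddCommGroup M] [Module R M] : Prop :=
  ∃ (P : Type u) (_ : AddCommGroup P) (_ : Module R P) (p : P →ₗ[R] M),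
    Module.Projective R P ∧ Function.Surjective p ∧ IsSuperfluous (LinearMap.ker p)

/-- A ring is semiperfect if every finitely generated module, left or right, has a projective
cover. Right `A`-modules are left modules over the opposite ring `Aᵐᵒᵖ`. -/
structure IsSemiperfect (A : Type u) [Ring A] : Prop where
  left : ∀ (M : Type u) [AddCommGroup M] [Module A M] [Module.Finite A M],
    HasProjectiveCover A M
  right : ∀ (M : Type u) [AddCommGroup M] [Module Aᵐᵒᵖ M] [Module.Finite Aᵐᵒᵖ M],
    HasProjectiveCover Aᵐᵒᵖ M

/-- The projective dimension of a module in `ℕ ∪ {∞}`, the zero module having dimension `0`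
(Mathlib's `projectiveDimension` gives it the value `⊥`). -/
noncomputable def projDim (R : Type u) [Ring R] (M : Type u) [AddCommGroup M] [Module R M] : ℕ∞ :=
  (projectiveDimension (ModuleCat.of R M)).unbotD 0

/-- The injective dimension of a module in `ℕ ∪ {∞}`, the zero module having dimension `0`
(Mathlib's `injectiveDimension` gives it the value `⊥`). -/
noncomputable def injDim (R : Type u) [Ring R] (M : Type u) [AddCommGroup M] [Module R M] : ℕ∞ :=
  (injectiveDimension (ModuleCat.of R M)).unbotD 0

/-- The (left) global dimension: the supremum of the projective dimensions of all (left) modules. -/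
noncomputable def globalDim (R : Type u) [Ring R] : ℕ∞ :=
  ⨆ M : ModuleCat.{u} R, projDim R M

/-- The Jacobson radical of `A`, a two-sided ideal, regarded as a right `A`-module through right
multiplication. -/
def jacobsonRight (A : Type u) [Ring A] : Submodule Aᵐᵒᵖ A where
  carrier := (Ring.jacobson A : Set A)
  add_mem' ha hb := (Ring.jacobson A).add_mem ha hb
  zero_mem' := (Ring.jacobson A).zero_mem
  smul_mem' c _ hx := (Ring.jacobson A).mul_mem_right c.unop hx

/-! ### Finite bounds on dimensions -/

open CategoryTheory Abelian MulOpposite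

/-! The key claim is that a finitely generated K with Ext¹(K, J) = 0 is projective. In a projective
cover P → K the kernel L lies in rad P. Embed P as a summand of Rᵐ; on L the coordinates take values
in J, so by the vanishing of Ext¹ they extend to maps P → J. Composing with the retraction Rᵐ → P
gives an endomorphism h of P with image in rad P and with h = id on L. Then id - h is onto by
Nakayama, hence injective as P is noetherian, yet it kills L; so L = 0
(`projective_of_ext_jacobson_eq_zero`). Dimension shifting and Auslander's theorem then give gl dim
≤ inj dim J; the other inequality is immediate.

The second claim needs equality of left and right global dimension for noetherian rings. This is a
Tor argument in terms of matrices: if right modules have projective dimension ≤ n, then Tor of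
degree n + 1 vanishes, and testing it on one cokernel shows that the n-th syzygy of a finitely
generated left module is projective (`globalDim_le_globalDim_op`). -/

theorem projDim_le_iff (R : Type u) [Ring R] (M : Type u) [AddCommGroup M] [Module R M] (n : ℕ) :
    projDim R M ≤ n ↔ HasProjectiveDimensionLE (ModuleCat.of R M) n := by
  rw [← projectiveDimension_le_iff, projDim]
  induction projectiveDimension (ModuleCat.of R M) with
  | bot => simp
  | coe d => simp only [WithBot.unbotD_coe]; exact WithBot.coe_le_coe.symm

theorem injDim_le_iff (R : Type u) [Ring R] (M : Type u) [AddCommGroup M] [Module R M] (n : ℕ) :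
    injDim R M ≤ n ↔ HasInjectiveDimensionLE (ModuleCat.of R M) n := by
  rw [← injectiveDimension_le_iff, injDim]
  induction injectiveDimension (ModuleCat.of R M) with
  | bot => simp
  | coe d => simp only [WithBot.unbotD_coe]; exact WithBot.coe_le_coe.symm

theorem globalDim_le_iff (R : Type u) [Ring R] (n : ℕ) :
    globalDim R ≤ n ↔ ∀ M : ModuleCat.{u} R, HasProjectiveDimensionLE M n := by
  rw [globalDim, iSup_le_iff]
  exact forall_congr' fun M => projDim_le_iff R M n

theorem ENat.eq_of_forall_natCast_ge_iff {a b : ℕ∞} (h : ∀ n : ℕ, a ≤ n ↔ b ≤ n) : a = b := by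
  refine eq_of_forall_ge_iff fun c => ?_
  induction c with
  | top => simp
  | coe n => exact h n

/-! ### Injective dimension of the radical -/

section

variable {R : Type u} [Ring R]

/-- If `Ext¹(K, Y) = 0`, maps into `Y` extend from the kernel of a surjection `P → K` to `P`. -/
theorem exists_extend_of_ext_one_eq_zero {P K Y : Type u} [AddCommGroup P] [Module R P]
    [AddCommGroup K] [Module R K] [AddCommGroup Y] [Module R Y] (p : P →ₗ[R] K)
    (hp : Function.Surjective p)
    (h : ∀ e : Ext (ModuleCat.of R K) (ModuleCat.of R Y) 1, e = 0)
    (f : LinearMap.ker p →ₗ[R] Y) : ∃ g : P →ₗ[R] Y, ∀ x : LinearMap.ker p, g x = f x := by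
  have hS := LinearMap.shortExact_shortComplexKer hp
  obtain ⟨x, hx⟩ := Ext.contravariant_sequence_exact₁ hS (ModuleCat.of R Y)
    (Ext.mk₀ (ModuleCat.ofHom f)) rfl (h _)
  obtain ⟨g, rfl⟩ := Ext.homEquiv₀.symm.surjective x
  rw [Ext.homEquiv₀_symm_apply, Ext.mk₀_comp_mk₀] at hx
  have hx := Ext.homEquiv₀.symm.injective hx
  exact ⟨g.hom, fun x => LinearMap.congr_fun (congrArg ModuleCat.Hom.hom hx) x⟩

/-- Baer's criterion for injective dimension. -/
theorem hasInjectiveDimensionLE_of_ext_quotient_eq_zero (n : ℕ) (Y : ModuleCat.{u} R)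
    (h : ∀ (I : Ideal R) (e : Ext (ModuleCat.of R (R ⧸ I)) Y (n + 1)), e = 0) :
    HasInjectiveDimensionLE Y n := by
  induction n generalizing Y with
  | zero =>
    refine injective_iff_hasInjectiveDimensionLT_one.mp ?_
    rw [← Module.injective_iff_injective_object R Y]
    refine Module.Baer.injective fun I g => ?_
    obtain ⟨g', hg'⟩ := exists_extend_of_ext_one_eq_zero I.mkQ I.mkQ_surjective (h I)
      (g ∘ₗ Submodule.inclusion I.ker_mkQ.le)
    exact ⟨g', fun x hx => hg' ⟨x, I.ker_mkQ.ge hx⟩⟩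
  | succ n ih =>
    let ⟨p⟩ := EnoughInjectives.presentation Y
    have hS : (ShortComplex.mk _ _ (Limits.cokernel.condition p.f)).ShortExact :=
      { exact := ShortComplex.exact_cokernel p.f }
    refine (hS.hasInjectiveDimensionLT_X₃_iff n p.injective).mp (ih _ fun I e => ?_)
    -- The connecting map sends `e` into Extⁿ⁺² with values in `Y`, which vanishes, so `e` comes
    -- from Extⁿ⁺¹ into an injective.
    obtain ⟨x, rfl⟩ := Ext.covariant_sequence_exact₃ _ hS e rfl (h I _)
    have : Injective p.J := p.injective
    rw [Ext.eq_zero_of_injective x, Ext.zero_comp]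

/-- Auslander's theorem: the global dimension is determined by cyclic modules. -/
theorem globalDim_le_of_quotient (n : ℕ)
    (h : ∀ I : Ideal R, HasProjectiveDimensionLE (ModuleCat.of R (R ⧸ I)) n) :
    globalDim R ≤ n := by
  have hinj (Y : ModuleCat.{u} R) : HasInjectiveDimensionLE Y n :=
    hasInjectiveDimensionLE_of_ext_quotient_eq_zero n Y fun I e =>
      e.eq_zero_of_hasProjectiveDimensionLT (n + 1) le_rfl
  refine (globalDim_le_iff R n).mpr fun M => HasProjectiveDimensionLT.mk fun i hi Y e => ?_
  have := hinj Y
  exact e.eq_zero_of_hasInjectiveDimensionLT (n + 1) hi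

variable {P : Type u} [AddCommGroup P] [Module R P]

/-- A maximal submodule not containing `L` would span everything together with `L`, contradicting
superfluity. -/
theorem IsSuperfluous.le_jacobson {L : Submodule R P} (hL : IsSuperfluous L) :
    L ≤ Module.jacobson R P := by
  refine le_sInf fun m hm => ?_
  by_contra hle
  refine hm.1 (hL m (hm.2 _ (lt_of_le_of_ne le_sup_left fun h => hle ?_)))
  exact h ▸ le_sup_right

/-- Nakayama's lemma: the radical of a finitely generated module is superfluous. -/
theorem isSuperfluous_jacobson [Module.Finite R P] : IsSuperfluous (Module.jacobson R P) := by
  intro N hN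
  by_contra hne
  obtain ⟨m, hm, hle⟩ := (eq_top_or_exists_le_coatom N).resolve_left hne
  exact hm.1 (top_le_iff.mp (hN ▸ sup_le hle (sInf_le hm)))

theorem Module.Finite.of_isSuperfluous_ker {K : Type u} [AddCommGroup K] [Module R K]
    [Module.Finite R K] (p : P →ₗ[R] K) (hp : Function.Surjective p)
    (hL : IsSuperfluous (LinearMap.ker p)) : Module.Finite R P := by
  obtain ⟨m, r, hr⟩ := Module.Finite.exists_fin' R K
  obtain ⟨s, hs⟩ := Module.projective_lifting_property p r hp
  refine Module.Finite.of_surjective s (LinearMap.range_eq_top.mp (hL _ ?_))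
  refine eq_top_iff.mpr fun x _ => ?_
  obtain ⟨y, hy⟩ := hr (p x)
  rw [← add_sub_cancel (s y) x]
  refine Submodule.add_mem_sup ⟨y, rfl⟩ ?_
  rw [LinearMap.mem_ker, map_sub, ← LinearMap.comp_apply, hs, hy, sub_self]

theorem projective_of_ext_jacobson_eq_zero [IsNoetherianRing R] (K : Type u) [AddCommGroup K]
    [Module R K] [Module.Finite R K] (hcov : HasProjectiveCover R K)
    (h : ∀ e : Ext (ModuleCat.of R K) (ModuleCat.of R (Ring.jacobson R)) 1, e = 0) :
    Module.Projective R K := by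
  obtain ⟨P, _, _, p, hP, hp, hL⟩ := hcov
  have hfin : Module.Finite R P := .of_isSuperfluous_ker p hp hL
  obtain ⟨m, r, hr⟩ := Module.Finite.exists_fin' R P
  obtain ⟨i, hi⟩ := Module.projective_lifting_property r LinearMap.id hr
  -- Linear maps carry radicals into radicals, and `ker p` lies in the radical of `P`.
  have hmem (j : Fin m) (x : LinearMap.ker p) : i x j ∈ Ring.jacobson R :=
    Module.le_comap_jacobson ((LinearMap.proj j : (Fin m → R) →ₗ[R] R) ∘ₗ i) (hL.le_jacobson x.2)
  choose g hg using fun j : Fin m => exists_extend_of_ext_one_eq_zero p hp h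
    ((((LinearMap.proj j : (Fin m → R) →ₗ[R] R) ∘ₗ i) ∘ₗ (LinearMap.ker p).subtype).codRestrict _
      (hmem j))
  let g' : P →ₗ[R] Fin m → R := LinearMap.pi fun j => (Ring.jacobson R).subtype ∘ₗ g j
  have hg' (x : P) (hx : p x = 0) : g' x = i x := by
    ext j
    exact congrArg Subtype.val (hg j ⟨x, hx⟩)
  have hrad (x : P) : r (g' x) ∈ Module.jacobson R P := by
    rw [← Finset.univ_sum_single (g' x), map_sum]
    refine Submodule.sum_mem _ fun j _ => ?_
    exact Module.le_comap_jacobson (r ∘ₗ LinearMap.single R (fun _ => R) j) (g j x).2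
  have hsurj : Function.Surjective ((LinearMap.id : P →ₗ[R] P) - r ∘ₗ g') := by
    rw [← LinearMap.range_eq_top]
    refine isSuperfluous_jacobson _ (eq_top_iff.mpr fun x _ => ?_)
    rw [← sub_add_cancel x (r (g' x))]
    exact Submodule.add_mem_sup ⟨x, rfl⟩ (hrad x)
  have hinj := IsNoetherian.injective_of_surjective_endomorphism _ hsurj
  have hker : Function.Injective p := by
    rw [injective_iff_map_eq_zero]
    -- On `ker p` the maps `g'` and `i` agree and `r ∘ i = id`, so `id - r ∘ g'` vanishes there.
    refine fun x hx => hinj ?_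
    have : r (i x) = x := LinearMap.congr_fun hi x
    simp [hg' x hx, this]
  exact Module.Projective.of_equiv (LinearEquiv.ofBijective p ⟨hker, hp⟩)

/-- Dimension shifting in the first variable; syzygies stay finitely generated because `R` is
noetherian. -/
theorem hasProjectiveDimensionLE_of_ext_jacobson_eq_zero [IsNoetherianRing R]
    (hcov : ∀ (M : Type u) [AddCommGroup M] [Module R M] [Module.Finite R M],
      HasProjectiveCover R M) (n : ℕ) (K : Type u) [AddCommGroup K] [Module R K]
    [Module.Finite R K]
    (h : ∀ e : Ext (ModuleCat.of R K) (ModuleCat.of R (Ring.jacobson R)) (n + 1), e = 0) :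
    HasProjectiveDimensionLE (ModuleCat.of R K) n := by
  induction n generalizing K with
  | zero =>
    have := projective_of_ext_jacobson_eq_zero K (hcov K) h
    exact (projective_iff_hasProjectiveDimensionLE_zero _).mp inferInstance
  | succ n ih =>
    obtain ⟨m, r, hr⟩ := Module.Finite.exists_fin' R K
    have hS := LinearMap.shortExact_shortComplexKer hr
    have hproj : Projective r.shortComplexKer.X₂ :=
      inferInstanceAs (Projective (ModuleCat.of R (Fin m → R)))
    refine (hS.hasProjectiveDimensionLT_X₃_iff n hproj).mpr (ih (LinearMap.ker r) fun e => ?_)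
    obtain ⟨x, rfl⟩ := Ext.contravariant_sequence_exact₁ hS _ e (add_comm 1 (n + 1)) (h _)
    rw [Ext.eq_zero_of_projective x, Ext.comp_zero]

/-- Over a left noetherian ring whose finitely generated modules have projective covers, the
injective dimension of the Jacobson radical is the global dimension. -/
theorem injDim_jacobson_eq_globalDim (R : Type u) [Ring R] [IsNoetherianRing R]
    (hcov : ∀ (M : Type u) [AddCommGroup M] [Module R M] [Module.Finite R M],
      HasProjectiveCover R M) : injDim R (Ring.jacobson R) = globalDim R := by
  refine ENat.eq_of_forall_natCast_ge_iff fun n => ⟨fun h => ?_, fun h => ?_⟩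
  · have := (injDim_le_iff ..).mp h
    exact globalDim_le_of_quotient n fun I =>
      hasProjectiveDimensionLE_of_ext_jacobson_eq_zero hcov n _ fun e =>
        e.eq_zero_of_hasInjectiveDimensionLT (n + 1) le_rfl
  · have := (globalDim_le_iff R n).mp h
    exact (injDim_le_iff ..).mpr <| HasInjectiveDimensionLT.mk fun i hi Y e =>
      have := this Y
      e.eq_zero_of_hasProjectiveDimensionLT (n + 1) hi

end

/-! ### Vanishing of Tor in matrix form -/

section

variable {S : Type u} [Ring S] {q p m : ℕ}

/-- The map `M ⊗ D : Mᵖ → Mᵐ` for a right module `M` and a matrix `D`. -/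
def rightVecMul (M : Type*) [AddCommGroup M] [Module Sᵐᵒᵖ M] (D : Matrix (Fin p) (Fin m) S) :
    (Fin p → M) →+ (Fin m → M) where
  toFun v j := ∑ k, op (D k j) • v k
  map_zero' := by ext; simp
  map_add' v w := by ext; simp [Finset.sum_add_distrib]

theorem rightVecMul_apply (M : Type*) [AddCommGroup M] [Module Sᵐᵒᵖ M]
    (D : Matrix (Fin p) (Fin m) S) (v : Fin p → M) (j : Fin m) :
    rightVecMul M D v j = ∑ k, op (D k j) • v k := rfl

theorem rightVecMul_map {M N : Type*} [AddCommGroup M] [Module Sᵐᵒᵖ M] [AddCommGroup N]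
    [Module Sᵐᵒᵖ N] (f : M →ₗ[Sᵐᵒᵖ] N) (D : Matrix (Fin p) (Fin m) S) (v : Fin p → M) :
    rightVecMul N D (fun k => f (v k)) = fun j => f (rightVecMul M D v j) := by
  ext j
  simp [rightVecMul_apply]

theorem rightVecMul_rightVecMul {M : Type*} [AddCommGroup M] [Module Sᵐᵒᵖ M]
    (D' : Matrix (Fin q) (Fin p) S) (D : Matrix (Fin p) (Fin m) S) (v : Fin q → M) :
    rightVecMul M D (rightVecMul M D' v) = rightVecMul M (D' * D) v := by
  ext j
  simp only [rightVecMul_apply, Matrix.mul_apply, Finset.smul_sum, smul_smul, Finset.op_sum,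
    Finset.sum_smul, op_mul]
  exact Finset.sum_comm

/-- Exactness of `M^q → M^p → M^m`, i.e. vanishing of `Tor` with coefficients in `M`. -/
def RightExact (M : Type*) [AddCommGroup M] [Module Sᵐᵒᵖ M] (D' : Matrix (Fin q) (Fin p) S)
    (D : Matrix (Fin p) (Fin m) S) : Prop :=
  ∀ v, rightVecMul M D v = 0 → ∃ w, rightVecMul M D' w = v

variable {D' : Matrix (Fin q) (Fin p) S} {D : Matrix (Fin p) (Fin m) S}

theorem RightExact.finsupp (h : ∀ x, Matrix.vecMul x D = 0 → ∃ y, Matrix.vecMul y D' = x)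
    (ι : Type*) : RightExact (ι →₀ Sᵐᵒᵖ) D' D := by
  classical
  -- Preimages are chosen coordinate by coordinate, with 0 chosen for 0 so that the result has
  -- finite support.
  have h' (x : Fin p → S) : ∃ y, (Matrix.vecMul x D = 0 → Matrix.vecMul y D' = x) ∧
      (x = 0 → y = 0) := by
    by_cases hx : x = 0
    · exact ⟨0, fun _ => by simp [hx], fun _ => rfl⟩
    · by_cases hxD : Matrix.vecMul x D = 0
      · exact (h x hxD).imp fun y hy => ⟨fun _ => hy, fun h => absurd h hx⟩
      · exact ⟨0, fun h => absurd h hxD, fun _ => rfl⟩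
  choose s hs hs0 using h'
  intro v hv
  refine ⟨fun l => Finsupp.onFinset (Finset.univ.biUnion fun k => (v k).support)
    (fun i => op (s (fun k => unop (v k i)) l)) fun i hi => ?_, ?_⟩
  · by_contra hmem
    refine hi ?_
    rw [hs0 _ (funext fun k => ?_)]
    · simp
    · simp only [Finset.mem_biUnion, Finset.mem_univ, true_and, not_exists,
        Finsupp.mem_support_iff, not_not] at hmem
      simp [hmem k]
  · ext k i
    have key := congrFun (hs (fun k => unop (v k i)) (funext fun j => ?_)) k
    · simp only [rightVecMul_apply, Finsupp.coe_finsetSum, Finset.sum_apply, Finsupp.smul_apply,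
        Finsupp.onFinset_apply, smul_eq_mul, ← op_mul, ← Finset.op_sum]
      exact unop_injective key
    · have := DFunLike.congr_fun (congrFun hv j) i
      simp only [rightVecMul_apply, Finsupp.coe_finsetSum, Finset.sum_apply, Finsupp.smul_apply,
        smul_eq_mul] at this
      have := congrArg unop this
      simpa [Matrix.vecMul, dotProduct] using this

theorem RightExact.of_retract {M N : Type*} [AddCommGroup M] [Module Sᵐᵒᵖ M] [AddCommGroup N]
    [Module Sᵐᵒᵖ N] (h : RightExact N D' D) (i : M →ₗ[Sᵐᵒᵖ] N) (r : N →ₗ[Sᵐᵒᵖ] M)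
    (hri : r ∘ₗ i = LinearMap.id) : RightExact M D' D := by
  intro v hv
  obtain ⟨w, hw⟩ := h (fun k => i (v k)) (by rw [rightVecMul_map, hv]; ext; simp)
  refine ⟨fun l => r (w l), ?_⟩
  rw [rightVecMul_map, hw]
  ext k
  exact LinearMap.congr_fun hri (v k)

theorem RightExact.of_projective {M : Type*} [AddCommGroup M] [Module Sᵐᵒᵖ M]
    [Module.Projective Sᵐᵒᵖ M]
    (h : ∀ x, Matrix.vecMul x D = 0 → ∃ y, Matrix.vecMul y D' = x) : RightExact M D' D := by
  obtain ⟨s, hs⟩ := Module.Projective.out (R := Sᵐᵒᵖ) (P := M)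
  exact (RightExact.finsupp h M).of_retract s (Finsupp.linearCombination Sᵐᵒᵖ id)
    (LinearMap.ext hs)

/-- Dimension shifting for `RightExact`. -/
theorem RightExact.of_ker {l : ℕ} {D'' : Matrix (Fin l) (Fin q) S} {F M : Type*}
    [AddCommGroup F] [Module Sᵐᵒᵖ F] [AddCommGroup M] [Module Sᵐᵒᵖ M] (f : F →ₗ[Sᵐᵒᵖ] M)
    (hf : Function.Surjective f) (hF : RightExact F D'' D')
    (hK : RightExact (LinearMap.ker f) D' D) (hD : D' * D = 0) : RightExact M D'' D' := by
  -- Lift `v` to `w` over `F`. Its image under `D'` is a cycle in the kernel, hence the image of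
  -- some `u` there; `w - u` is then a cycle over `F`, hence a boundary, and still lifts `v`.
  intro v hv
  choose w hw using fun k => hf (v k)
  obtain rfl : (fun k => f (w k)) = v := funext hw
  rw [rightVecMul_map] at hv
  obtain ⟨u, hu⟩ := hK (fun k => ⟨rightVecMul F D' w k, congrFun hv k⟩) <| by
    ext j
    have := congrFun (rightVecMul_map (LinearMap.ker f).subtype D
      (fun k => ⟨rightVecMul F D' w k, congrFun hv k⟩)) j
    refine this.symm.trans ?_
    change rightVecMul F D (rightVecMul F D' w) j = 0
    rw [rightVecMul_rightVecMul, hD]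
    simp [rightVecMul_apply]
  have hu' : rightVecMul F D' (fun k => (u k : F)) = rightVecMul F D' w := by
    have := rightVecMul_map (LinearMap.ker f).subtype D' u
    rw [hu] at this
    exact this
  obtain ⟨z, hz⟩ := hF (w - fun k => (u k : F)) (by rw [map_sub, hu', sub_self])
  refine ⟨fun k => f (z k), ?_⟩
  rw [rightVecMul_map, hz]
  ext k
  simp

/-- If `Tor` with coefficients in the module generated by the columns vanishes, then `D` has a
projective cokernel. -/
theorem exists_mul_mul_eq_of_rightExact (hD : D' * D = 0)
    (h : RightExact ((Fin p → Sᵐᵒᵖ) ⧸ Submodule.span Sᵐᵒᵖ (Set.range fun j k => op (D k j))) D' D) :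
    ∃ U : Matrix (Fin m) (Fin p) S, D * U * D = D := by
  classical
  set N := Submodule.span Sᵐᵒᵖ (Set.range fun j k => op (D k j)) with hN
  -- The classes of the standard basis vectors form a cycle, since `D` sends them to its own
  -- columns, which are zero in the quotient. Writing the cycle as a boundary gives `1 - W * D' = D
  -- * U`; multiply by `D` on the right.
  obtain ⟨w, hw⟩ := h (fun k => N.mkQ (Pi.single k 1)) <| by
    rw [rightVecMul_map]
    ext j
    refine (Submodule.Quotient.mk_eq_zero N).mpr (Submodule.subset_span ⟨j, ?_⟩)
    ext k
    simp [rightVecMul_apply, Finset.sum_apply, Pi.single_apply]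
  choose W hW using fun l => N.mkQ_surjective (w l)
  obtain rfl : (fun l => N.mkQ (W l)) = w := funext hW
  rw [rightVecMul_map] at hw
  have hmem (k : Fin p) : Pi.single k 1 - rightVecMul _ D' W k ∈ N :=
    (Submodule.Quotient.eq N).mp (congrFun hw k).symm
  simp only [hN, Submodule.mem_span_range_iff_exists_fun] at hmem
  choose U hU using hmem
  have key : 1 - (Matrix.of fun k l => unop (W l k)) * D' =
      D * Matrix.of fun j k => unop (U k j) := by
    ext a b
    have := congrArg unop (congrFun (hU b) a)
    simp only [Finset.sum_apply, Pi.smul_apply, Pi.sub_apply, rightVecMul_apply, smul_eq_mul,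
      unop_mul, unop_op, Finset.unop_sum] at this
    simp only [Matrix.sub_apply, Matrix.mul_apply, Matrix.of_apply, this]
    simp [Matrix.one_apply, Pi.single_apply, apply_ite unop]
  refine ⟨Matrix.of fun j k => unop (U k j), ?_⟩
  rw [← key, Matrix.sub_mul, Matrix.mul_assoc, hD]
  simp

end

/-! ### Matrix resolutions and left-right symmetry -/

section

variable {S : Type u} [Ring S]

/-- The cokernel of `D` acting on row vectors. -/
abbrev RowCoker {p m : ℕ} (D : Matrix (Fin p) (Fin m) S) : Type u :=
  (Fin m → S) ⧸ LinearMap.range D.vecMulLinear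

/-- The map x ↦ x - xUD kills the row space of `D` and changes x only by an element of it, so it
splits the quotient map. -/
theorem projective_rowCoker {p m : ℕ} {D : Matrix (Fin p) (Fin m) S}
    {U : Matrix (Fin m) (Fin p) S} (hU : D * U * D = D) : Module.Projective S (RowCoker D) := by
  let f : (Fin m → S) →ₗ[S] Fin m → S := LinearMap.id - (U * D).vecMulLinear
  have hf : LinearMap.range D.vecMulLinear ≤ LinearMap.ker f := by
    rintro _ ⟨x, rfl⟩
    simp [f, Matrix.vecMul_vecMul, ← Matrix.mul_assoc, hU]
  refine Module.Projective.of_split ((LinearMap.range D.vecMulLinear).liftQ f hf)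
    (LinearMap.range D.vecMulLinear).mkQ ?_
  ext x
  refine (Submodule.Quotient.eq _).mpr ⟨-(Matrix.vecMul (Pi.single x 1) U), ?_⟩
  simp [f, ← Matrix.vecMul_vecMul]

/-- A sequence of matrices describing a free resolution by row vectors. -/
structure MatrixResolution (S : Type u) [Ring S] where
  rank : ℕ → ℕ
  d : ∀ i, Matrix (Fin (rank (i + 1))) (Fin (rank i)) S
  exact : ∀ i x, Matrix.vecMul x (d i) = 0 ↔ ∃ y, Matrix.vecMul y (d (i + 1)) = x

namespace MatrixResolution

variable (F : MatrixResolution S)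

theorem d_mul_d (i : ℕ) : F.d (i + 1) * F.d i = 0 := by
  classical
  ext a b
  have := (F.exact i _).mpr ⟨Pi.single a 1, rfl⟩
  rw [Matrix.vecMul_vecMul] at this
  simpa using congrFun this b

theorem rightExact (n : ℕ) (M : ModuleCat.{u} Sᵐᵒᵖ) [HasProjectiveDimensionLE M n] :
    RightExact M (F.d (n + 1)) (F.d n) := by
  induction n generalizing M with
  | zero =>
    have hM : Projective M := (projective_iff_hasProjectiveDimensionLE_zero M).mpr inferInstance
    have : Module.Projective Sᵐᵒᵖ M := M.projective_of_module_projective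
    exact .of_projective fun x => (F.exact 0 x).mp
  | succ n ih =>
    have hS := M.shortExact_projectiveShortComplex
    have hK := (hS.hasProjectiveDimensionLT_X₃_iff n inferInstance).mp ‹_›
    exact .of_ker M.projectiveShortComplex.g.hom
      ((ModuleCat.epi_iff_surjective _).mp hS.epi_g)
      (.of_projective (M := M.projectiveShortComplex.X₂) fun x => (F.exact (n + 1) x).mp)
      (ih M.projectiveShortComplex.X₁) (F.d_mul_d n)

/-- The image of one differential is the cokernel of the next. -/
noncomputable def rowCokerEquiv (i : ℕ) :
    RowCoker (F.d (i + 1)) ≃ₗ[S] LinearMap.range (F.d i).vecMulLinear :=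
  (Submodule.quotEquivOfEq _ _ (Submodule.ext fun x => (F.exact i x).symm)).trans
    (F.d i).vecMulLinear.quotKerEquivRange

theorem hasProjectiveDimensionLE_rowCoker (n i : ℕ)
    (h : Module.Projective S (RowCoker (F.d (i + n)))) :
    HasProjectiveDimensionLE (ModuleCat.of S (RowCoker (F.d i))) n := by
  induction n generalizing i with
  | zero =>
    exact (projective_iff_hasProjectiveDimensionLE_zero _).mp
      (inferInstanceAs (Projective (ModuleCat.of S (RowCoker (F.d (i + 0))))))
  | succ n ih =>
    let N := LinearMap.range (F.d i).vecMulLinear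
    have hS := LinearMap.shortExact_shortComplexKer N.mkQ_surjective
    have hproj : Projective N.mkQ.shortComplexKer.X₂ :=
      inferInstanceAs (Projective (ModuleCat.of S (Fin (F.rank i) → S)))
    refine (hS.hasProjectiveDimensionLT_X₃_iff n hproj).mpr ?_
    have hin : i + (n + 1) = i + 1 + n := by lia
    have := ih (i + 1) (hin ▸ h)
    exact hasProjectiveDimensionLT_of_iso
      ((F.rowCokerEquiv i).trans (LinearEquiv.ofEq _ _ N.ker_mkQ.symm)).toModuleIso _

end MatrixResolution

theorem exists_matrix_range_eq [IsNoetherianRing S] {m : ℕ} (N : Submodule S (Fin m → S)) :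
    ∃ (q : ℕ) (D : Matrix (Fin q) (Fin m) S), LinearMap.range D.vecMulLinear = N := by
  obtain ⟨q, s, hs⟩ := Submodule.fg_iff_exists_fin_generating_family.mp
    (IsNoetherian.noetherian N)
  exact ⟨q, Matrix.of s, (range_vecMulLinear _).trans hs⟩

theorem MatrixResolution.exists_of_finite [IsNoetherianRing S] (M : Type*) [AddCommGroup M]
    [Module S M] [Module.Finite S M] :
    ∃ F : MatrixResolution S, Nonempty (RowCoker (F.d 0) ≃ₗ[S] M) := by
  obtain ⟨m, r, hr⟩ := Module.Finite.exists_fin' S M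
  obtain ⟨p, D, hD⟩ := exists_matrix_range_eq (LinearMap.ker r)
  choose q D' hD' using fun X : Σ m p : ℕ, Matrix (Fin p) (Fin m) S =>
    exists_matrix_range_eq (LinearMap.ker X.2.2.vecMulLinear)
  -- Each state carries its sizes along, so that consecutive matrices have definitionally matching
  -- dimensions.
  let X (i : ℕ) : Σ m p : ℕ, Matrix (Fin p) (Fin m) S :=
    Nat.rec ⟨m, p, D⟩ (fun _ X => ⟨X.2.1, q X, D' X⟩) i
  let F : MatrixResolution S :=
    { rank := fun i => (X i).1
      d := fun i => (X i).2.2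
      exact := fun i x => (SetLike.ext_iff.mp (hD' (X i)) x).symm }
  exact ⟨F, ⟨(Submodule.quotEquivOfEq _ _ hD).trans (r.quotKerEquivOfSurjective hr)⟩⟩

theorem globalDim_le_globalDim_op (S : Type u) [Ring S] [IsNoetherianRing S] :
    globalDim S ≤ globalDim Sᵐᵒᵖ := by
  suffices h : ∀ n : ℕ, globalDim Sᵐᵒᵖ ≤ n → globalDim S ≤ n by
    cases hn : globalDim Sᵐᵒᵖ with
    | top => exact le_top
    | coe n => exact h n hn.le
  refine fun n hn => globalDim_le_of_quotient n fun I => ?_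
  obtain ⟨F, ⟨e⟩⟩ := MatrixResolution.exists_of_finite (S := S) (S ⧸ I)
  -- The test module is the cokernel of `F.d n` acting on columns.
  have hM := (globalDim_le_iff Sᵐᵒᵖ n).mp hn (ModuleCat.of Sᵐᵒᵖ ((Fin (F.rank (n + 1)) → Sᵐᵒᵖ) ⧸
    Submodule.span Sᵐᵒᵖ (Set.range fun j k => op (F.d n k j))))
  obtain ⟨U, hU⟩ := exists_mul_mul_eq_of_rightExact (F.d_mul_d n)
    (F.rightExact n (ModuleCat.of _ _))
  have := F.hasProjectiveDimensionLE_rowCoker n 0 (by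
    rw [zero_add]
    exact projective_rowCoker hU)
  exact hasProjectiveDimensionLT_of_iso e.toModuleIso _

attribute [local instance] RingHomInvPair.of_ringEquiv in
theorem globalDim_le_of_ringEquiv {R R' : Type u} [Ring R] [Ring R'] (e : R ≃+* R') :
    globalDim R' ≤ globalDim R := by
  refine iSup_le fun M => ?_
  let : Module R M := Module.compHom M e.toRingHom
  let e' : ModuleCat.of R M ≃ₛₗ[RingHomClass.toRingHom e] M :=
    { AddEquiv.refl M with map_smul' := fun _ _ => rfl }
  refine le_trans (le_of_eq ?_)
    (le_iSup (fun N : ModuleCat.{u} R => projDim R N) (ModuleCat.of R M))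
  exact congrArg _ (ModuleCat.projectiveDimension_eq_of_semiLinearEquiv e e').symm

/-- A left inverse z of 1 + xy is itself 1 plus a radical element, so z is left invertible too;
hence z is a two-sided inverse, which gives the condition on the other side. -/
theorem op_mem_jacobson {A : Type*} [Ring A] {x : A} (hx : x ∈ Ring.jacobson A) :
    op x ∈ Ring.jacobson Aᵐᵒᵖ := by
  have left_inv {a : A} (ha : a ∈ Ring.jacobson A) : ∃ z, z * (1 + a) = 1 := by
    rw [← Ideal.jacobson_bot, Ideal.mem_jacobson_iff] at ha
    obtain ⟨z, hz⟩ := ha 1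
    refine ⟨z, ?_⟩
    rw [Ideal.mem_bot, sub_eq_zero, mul_one] at hz
    rw [mul_add, mul_one, add_comm, hz]
  rw [← Ideal.jacobson_bot, Ideal.mem_jacobson_iff]
  intro y
  have hxy : x * unop y ∈ Ring.jacobson A := (Ring.jacobson A).mul_mem_right _ hx
  obtain ⟨z, hz⟩ := left_inv hxy
  obtain ⟨w, hw⟩ := left_inv (a := z - 1) <| by
    have : z - 1 = -(z * (x * unop y)) := by
      rw [mul_add, mul_one] at hz
      rw [sub_eq_iff_eq_add, ← hz]
      abel
    rw [this]
    exact neg_mem ((Ring.jacobson A).mul_mem_left _ hxy)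
  rw [add_sub_cancel] at hw
  obtain rfl : w = 1 + x * unop y := left_inv_eq_right_inv hw hz
  refine ⟨op z, ?_⟩
  rw [Ideal.mem_bot, sub_eq_zero, ← unop_inj]
  change x * (unop y * z) + z = 1
  rw [← hw]
  noncomm_ring

theorem op_mem_jacobson_iff {A : Type*} [Ring A] {x : A} :
    op x ∈ Ring.jacobson Aᵐᵒᵖ ↔ x ∈ Ring.jacobson A := by
  refine ⟨fun hx => ?_, op_mem_jacobson⟩
  have := Ring.le_comap_jacobson ((RingEquiv.opOp A).symm : Aᵐᵒᵖᵐᵒᵖ →+* A)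
    (op_mem_jacobson hx)
  exact this

/-- The Jacobson radical of `Aᵐᵒᵖ` is that of `A`, regarded as a right module. -/
def jacobsonOpEquiv (A : Type u) [Ring A] : Ring.jacobson Aᵐᵒᵖ ≃ₗ[Aᵐᵒᵖ] jacobsonRight A where
  toFun x := ⟨unop x.1, op_mem_jacobson_iff.mp x.2⟩
  invFun x := ⟨op x.1, op_mem_jacobson_iff.mpr x.2⟩
  map_add' _ _ := rfl
  map_smul' _ _ := rfl

theorem injDim_eq_of_linearEquiv {R : Type u} [Ring R] {M N : Type u} [AddCommGroup M]
    [Module R M] [AddCommGroup N] [Module R N] (e : M ≃ₗ[R] N) : injDim R M = injDim R N :=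
  congrArg _ (injectiveDimension_eq_of_iso e.toModuleIso)

end

theorem theorem2p5 (A : Type u) [Ring A] [IsNoetherianRing A] [IsNoetherianRing Aᵐᵒᵖ]
    (hA : IsSemiperfect A) :
    injDim A (Ring.jacobson A) = globalDim A ∧
      injDim A (Ring.jacobson A) = injDim Aᵐᵒᵖ (jacobsonRight A) := by
  have hleft := injDim_jacobson_eq_globalDim A hA.left
  refine ⟨hleft, ?_⟩
  rw [hleft, ← injDim_eq_of_linearEquiv (jacobsonOpEquiv A),
    injDim_jacobson_eq_globalDim Aᵐᵒᵖ hA.right]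
  exact le_antisymm (globalDim_le_globalDim_op A)
    ((globalDim_le_globalDim_op Aᵐᵒᵖ).trans (globalDim_le_of_ringEquiv (RingEquiv.opOp A)))
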